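/- Let $k\ge 1$, $\mathcal H=(\mathbb C^2)^{\otimes k}=\mathbb C^{2^k}$, and let $\mathcal D(\mathcal H)$ be the set of density matrices (positive semidefinite, trace one) on $\mathcal H$. Let $S\subset\mathbb B(\mathcal H)$ satisfy $S=S^*$ and generate a Hörmander system, i.e. the real Lie algebra generated by the anti-Hermitian operators in the complex span of $S$ contains $\mathfrak{su}(2^k)$. For an operator $a$ put $L_a(\rho)=2a\rho a^*-a^*a\rho-\rho a^*a$. Let $\mathcal E(S)$ be the smallest class of linear maps on $\mathbb B(\mathcal H)$ which contains $\rho\mapsto e^{itH}\rho e^{-itH}$ for all $t\ge 0$ and all Hermitian $H$ with $iH\in\mathrm{span}_{\mathbb C}(S)$, contains $e^{tL_a}$ for all $t\ge 0$ and $a\in S$, and is closed under composition; let $\overline{\mathcal E(S)}$ be its topological closure (no convex combinations are taken). Write $D_S(\rho)=\{\Phi(\rho):\Phi\in\overline{\mathcal E(S)}\}$, $|0_k\rangle=|0\cdots0\rangle$, $Z=\mathrm{diag}(1,-1)$, and let $E_\infty$ be the projection of the $2\times 2$ matrices onto the diagonal ones, $E_\infty\big((\rho_{ij})\big)=\mathrm{diag}(\rho_{00},\rho_{11})$.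 Then: 1. If $|0\rangle\langle 1|\otimes I^{\otimes(k-1)}\in S$, then $\{\rho_1\otimes\cdots\otimes\rho_k:\rho_j\in\mathcal D(\mathbb C^2)\}\subset D_S(|0_k\rangle\langle 0_k|)$. 2. If $Z\otimes I^{\otimes(k-1)}\in S$, then $E_\infty\otimes\mathrm{id}^{\otimes(k-1)}$ and $E_\infty^{\otimes k}$ belong to $\overline{\mathcal E(S)}$. 3. If both $|0\rangle\langle 1|\otimes I^{\otimes(k-1)}$ and $Z\otimes I^{\otimes(k-1)}$ belong to $S$, then $D_S(|0_k\rangle\langle 0_k|)=\mathcal D(\mathcal H)$, and $\overline{\mathcal E(S)}$ is transitive on $\mathcal D(\mathcal H)$: for all $\rho,\sigma\in\mathcal D(\mathcal H)$ there is $\Phi\in\overline{\mathcal E(S)}$ with $\Phi(\rho)=\sigma$. -/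

import Mathlib

open scoped Matrix Matrix.Norms.L2Operator ComplexOrder

attribute [local instance] LieRing.ofAssociativeRing

noncomputable section

namespace QubitControl

section General

variable {n : Type*} [Fintype n] [DecidableEq n]

/-- Superoperators on the `n × n` complex matrices. All norms on this finite-dimensional space are
equivalent; the matrices carry the operator norm and superoperators the induced norm. -/
abbrev Superop (n : Type*) [Fintype n] [DecidableEq n] : Type _ :=
  Matrix n n ℂ →L[ℂ] Matrix n n ℂ

/-- The space of densities: positive semidefinite matrices of trace one. -/
def densities (n : Type*) [Fintype n] : Set (Matrix n n ℂ) :=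
  {ρ | ρ.PosSemidef ∧ ρ.trace = 1}

/-- `𝔰𝔲(n)`: the traceless anti-Hermitian matrices. -/
def su (n : Type*) [Fintype n] : Set (Matrix n n ℂ) :=
  {A | Aᴴ = -A ∧ A.trace = 0}

/-- The anti-Hermitian operators in the complex linear span of `S`. -/
def antiHermitianSpan (S : Set (Matrix n n ℂ)) : Set (Matrix n n ℂ) :=
  {A | A ∈ Submodule.span ℂ S ∧ Aᴴ = -A}

/-- `S` generates a Hörmander system: the real Lie algebra generated, under the commutator, by the
anti-Hermitian operators in the span of `S` contains all of `𝔰𝔲(n)`. (It is then `𝔰𝔲(n)` itself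
or, if a generator has non-zero trace, `𝔲(n)`.) -/
def GeneratesHormander (S : Set (Matrix n n ℂ)) : Prop :=
  su n ⊆ (LieSubalgebra.lieSpan ℝ (Matrix n n ℂ) (antiHermitianSpan S) : Set (Matrix n n ℂ))

/-- Unitary conjugation `ρ ↦ U ρ U*`. -/
def conj (U : Matrix n n ℂ) : Superop n :=
  ContinuousLinearMap.mulLeftRight ℂ (Matrix n n ℂ) U Uᴴ

theorem conj_apply (U ρ : Matrix n n ℂ) : conj U ρ = U * ρ * Uᴴ := rfl

/-- The Lindblad generator of the jump operator `a`, `ρ ↦ 2 a ρ a* - a* a ρ - ρ a* a`. -/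
def lindblad (a : Matrix n n ℂ) : Superop n :=
  (2 : ℂ) • ContinuousLinearMap.mulLeftRight ℂ (Matrix n n ℂ) a aᴴ
    - ContinuousLinearMap.mulLeftRight ℂ (Matrix n n ℂ) (aᴴ * a) 1
    - ContinuousLinearMap.mulLeftRight ℂ (Matrix n n ℂ) 1 (aᴴ * a)

theorem lindblad_apply (a ρ : Matrix n n ℂ) :
    lindblad a ρ = (2 : ℂ) • (a * ρ * aᴴ) - aᴴ * a * ρ - ρ * (aᴴ * a) := by
  simp [lindblad]

/-- The evolutions induced by the resource set `S`: the smallest class of superoperators that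
contains the unitary evolutions `ρ ↦ e^{itH} ρ e^{-itH}`, `t ≥ 0`, for every Hermitian `H` with
`iH` in the complex span of `S`, contains the jump semigroups `e^{t L_a}`, `t ≥ 0`, for `a ∈ S`,
and is closed under composition. -/
inductive Chan (S : Set (Matrix n n ℂ)) : Superop n → Prop
  | unitary (H : Matrix n n ℂ) (hH : H.IsHermitian)
      (hS : Complex.I • H ∈ Submodule.span ℂ S) (t : ℝ) (ht : 0 ≤ t) :
      Chan S (conj (NormedSpace.exp (((t : ℂ) * Complex.I) • H)))
  | jump (a : Matrix n n ℂ) (ha : a ∈ S) (t : ℝ) (ht : 0 ≤ t) :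
      Chan S (NormedSpace.exp ((t : ℂ) • lindblad a))
  | comp (Φ Ψ : Superop n) (hΦ : Chan S Φ) (hΨ : Chan S Ψ) : Chan S (Φ.comp Ψ)

/-- The closure of the class of evolutions in the finite-dimensional space of superoperators. -/
def closedChan (S : Set (Matrix n n ℂ)) : Set (Superop n) :=
  closure {Φ | Chan S Φ}

/-- The range of a density `ρ`: all images of `ρ` under the closed class. -/
def reach (S : Set (Matrix n n ℂ)) (ρ : Matrix n n ℂ) : Set (Matrix n n ℂ) :=
  {σ | ∃ Φ ∈ closedChan S, Φ ρ = σ}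

/-- A set of operations is transitive when every density is sent to every density by one of
them. -/
def IsTransitive (O : Set (Superop n)) : Prop :=
  ∀ ρ ∈ densities n, ∀ σ ∈ densities n, ∃ Φ ∈ O, Φ ρ = σ

end General

section Qubits

/-- Labels of the computational basis of `k` qubits, i.e. of `(ℂ²)^{⊗k} = ℂ^{2^k}`. -/
abbrev Bits (k : ℕ) : Type := Fin k → Fin 2

variable {k : ℕ}

/-- The tensor product `A₁ ⊗ ⋯ ⊗ A_k` of one-qubit operators, in the computational basis. -/
def tensor (A : Fin k → Matrix (Fin 2) (Fin 2) ℂ) : Matrix (Bits k) (Bits k) ℂ :=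
  Matrix.of fun x y => ∏ j, A j (x j) (y j)

/-- `I ⊗ ⋯ ⊗ A ⊗ ⋯ ⊗ I`, with `A` in register `j`. -/
def onRegister (j : Fin k) (A : Matrix (Fin 2) (Fin 2) ℂ) : Matrix (Bits k) (Bits k) ℂ :=
  tensor (Function.update (fun _ => 1) j A)

/-- The amplitude-damping jump `|0⟩⟨1|` of one qubit. -/
def lowering : Matrix (Fin 2) (Fin 2) ℂ := !![0, 1; 0, 0]

/-- The Pauli matrix `Z`. -/
def pauliZ : Matrix (Fin 2) (Fin 2) ℂ := !![1, 0; 0, -1]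

/-- The pure state `|0⋯0⟩⟨0⋯0|`. -/
def zeroState (k : ℕ) : Matrix (Bits k) (Bits k) ℂ :=
  Matrix.single (fun _ => 0) (fun _ => 0) 1

/-- The projection onto the diagonal in one qubit. -/
def dephase : Matrix (Fin 2) (Fin 2) ℂ →ₗ[ℂ] Matrix (Fin 2) (Fin 2) ℂ where
  toFun ρ := Matrix.diagonal fun i => ρ i i
  map_add' ρ σ := by ext i j; by_cases h : i = j <;> simp [h]
  map_smul' c ρ := by ext i j; by_cases h : i = j <;> simp [h]

/-- The tensor product `Φ₁ ⊗ ⋯ ⊗ Φ_k` of one-qubit superoperators: the linear map that sends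
`|x⟩⟨y| = |x₁⟩⟨y₁| ⊗ ⋯ ⊗ |x_k⟩⟨y_k|` to `Φ₁(|x₁⟩⟨y₁|) ⊗ ⋯ ⊗ Φ_k(|x_k⟩⟨y_k|)`. -/
def tensorSuperop (Φ : Fin k → (Matrix (Fin 2) (Fin 2) ℂ →ₗ[ℂ] Matrix (Fin 2) (Fin 2) ℂ)) :
    Superop (Bits k) :=
  LinearMap.toContinuousLinearMap
    (∑ x : Bits k, ∑ y : Bits k,
      (Matrix.entryLinearMap ℂ ℂ x y).smulRight
        (tensor fun j => Φ j (Matrix.single (x j) (y j) 1)))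

end Qubits

end QubitControl

end

open QubitControl

namespace QubitControl

open Filter Topology

/-! ### Product formulas for exponentials in a Banach algebra. -/

section Chernoff

/-! The closed class is a closed semigroup, and the matrices whose full one-parameter group acts
inside it (`flows`) form a closed real Lie algebra: Trotter's formula gives sums, and brackets arise
as derivatives of conjugated flows. This algebra contains the anti-Hermitian span of `S`, hence all
of `su`. A unitary is an exponential up to a phase, and phases are invisible to conjugation, so
every unitary conjugation is available (`conj_mem_closedChan`).

With all unitaries at hand, swaps carry the dissipation of one register to every other. On each
register the jump generators are diagonalized explicitly, so their long-time limits are visible: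
`pauliZ` gives the dephasing, `lowering` the reset to the ground state. Stopping the damping of an
excited qubit at the right time produces any spectrum on one qubit, and register by register any
product density.

For a general density with spectrum `p`, rotate the zero state to a pure state with amplitudes `√p`,
dephase all registers to get the diagonal density `p`, and rotate to the eigenbasis. Nothing else is
reached, because Chernoff's formula exhibits jump semigroups as limits of positive maps.
Transitivity follows by first resetting all registers. -/

theorem hasDerivAt_exp_smul_zero {𝔸 : Type*} [NormedRing 𝔸] [NormedAlgebra ℝ 𝔸] [CompleteSpace 𝔸]
    (X : 𝔸) : HasDerivAt (fun h : ℝ => NormedSpace.exp (h • X)) X 0 := by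
  simpa using hasDerivAt_exp_smul_const (𝕂 := ℝ) X 0

variable {𝔸 : Type*} [NormedRing 𝔸] [NormOneClass 𝔸]

/-- Powers of two elements of norm at most `M` differ by at most a multiple of their
difference. -/
theorem norm_pow_sub_pow_le {a b : 𝔸} {M : ℝ} (hM : 1 ≤ M) (ha : ‖a‖ ≤ M) (hb : ‖b‖ ≤ M) (n : ℕ) :
    ‖a ^ n - b ^ n‖ ≤ n * M ^ n * ‖a - b‖ := by
  have hM0 : 0 ≤ M := by linarith
  induction n with
  | zero => simp
  | succ n ih =>
    have e : a ^ (n + 1) - b ^ (n + 1) = a ^ n * (a - b) + (a ^ n - b ^ n) * b := by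
      rw [pow_succ, pow_succ]; noncomm_ring
    have h1 : ‖a ^ n * (a - b)‖ ≤ M ^ n * ‖a - b‖ :=
      (norm_mul_le _ _).trans (mul_le_mul_of_nonneg_right
        ((norm_pow_le a n).trans (pow_le_pow_left₀ (norm_nonneg _) ha n)) (norm_nonneg _))
    have h2 : ‖(a ^ n - b ^ n) * b‖ ≤ n * M ^ n * ‖a - b‖ * M :=
      (norm_mul_le _ _).trans (mul_le_mul ih hb (norm_nonneg _) (by positivity))
    have h3 : M ^ n ≤ M ^ (n + 1) := pow_le_pow_right₀ hM (Nat.le_succ n)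
    have h4 := mul_le_mul_of_nonneg_right h3 (norm_nonneg (a - b))
    rw [e]
    refine (norm_add_le _ _).trans ?_
    push_cast
    calc _ ≤ M ^ (n + 1) * ‖a - b‖ + n * M ^ n * ‖a - b‖ * M := by linarith
      _ = _ := by ring

variable [NormedAlgebra ℝ 𝔸] [CompleteSpace 𝔸]

/-- **Chernoff's product formula**: a curve through `1` with velocity `X` satisfies
`F (1 / n) ^ n → exp X`. -/
theorem tendsto_pow_exp {F : ℝ → 𝔸} {X : 𝔸} (h0 : F 0 = 1) (hF : HasDerivAt F X 0) :
    Tendsto (fun n : ℕ => F (1 / n) ^ n) atTop (𝓝 (NormedSpace.exp X)) := by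
  let E : ℝ → 𝔸 := fun h => NormedSpace.exp (h • X)
  have hE0 : E 0 = 1 := by simp [E]
  have hE : HasDerivAt E X 0 := hasDerivAt_exp_smul_zero X
  have bound : ∀ G : ℝ → 𝔸, G 0 = 1 → HasDerivAt G X 0 →
      ∀ᶠ h in 𝓝 (0 : ℝ), ‖G h‖ ≤ 1 + (‖X‖ + 1) * |h| := by
    intro G hG0 hG
    have := (hasDerivAt_iff_isLittleO.1 hG).def one_pos
    filter_upwards [this] with h hh
    simp only [sub_zero, hG0, one_mul, Real.norm_eq_abs] at hh
    have e : G h = 1 + h • X + (G h - 1 - h • X) := by abel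
    rw [e]
    have h1 := norm_add₃_le (a := (1 : 𝔸)) (b := h • X) (c := G h - 1 - h • X)
    rw [norm_one, norm_smul, Real.norm_eq_abs] at h1
    linarith
  have hdiff : HasDerivAt (fun h => F h - E h) 0 0 := by simpa using! hF.fun_sub hE
  have hinv : Tendsto (fun n : ℕ => (1 / n : ℝ)) atTop (𝓝 0) := tendsto_one_div_atTop_nhds_zero_nat
  -- The two curves agree to first order at `0`, so their distance at `1 / n` is `o(1 / n)`; this
  -- beats the factor `n` lost in comparing `n`-th powers.
  have hlit : Tendsto (fun n : ℕ => (n : ℝ) * ‖F (1 / n) - E (1 / n)‖) atTop (𝓝 0) := by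
    have h1 := (hasDerivAt_iff_isLittleO.1 hdiff)
    simp only [h0, hE0, sub_self, sub_zero, smul_zero] at h1
    have h2 := (h1.comp_tendsto hinv).norm_left.tendsto_div_nhds_zero
    refine h2.congr fun n => ?_
    simp [div_eq_mul_inv, mul_comm]
  have hzero : Tendsto (fun n : ℕ => F (1 / n) ^ n - E (1 / n) ^ n) atTop (𝓝 0) := by
    rw [tendsto_zero_iff_norm_tendsto_zero]
    have hC : Tendsto (fun n : ℕ => Real.exp (‖X‖ + 1) * ((n : ℝ) * ‖F (1 / n) - E (1 / n)‖))
        atTop (𝓝 0) := by simpa using hlit.const_mul (Real.exp (‖X‖ + 1))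
    refine squeeze_zero' (Eventually.of_forall fun _ => norm_nonneg _) ?_ hC
    filter_upwards [hinv.eventually (bound F h0 hF), hinv.eventually (bound E hE0 hE),
      eventually_gt_atTop 0] with n h1 h2 hn
    have hn' : (0 : ℝ) < n := by exact_mod_cast hn
    have hM : 1 ≤ 1 + (‖X‖ + 1) * |(1 / n : ℝ)| := by
      have := norm_nonneg X
      have : 0 ≤ (‖X‖ + 1) * |(1 / n : ℝ)| := by positivity
      linarith
    refine (norm_pow_sub_pow_le hM h1 h2 n).trans ?_
    -- The bound `(1 + c / n) ^ n ≤ exp c` makes the powers bounded uniformly in `n`.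
    have h3 : (1 + (‖X‖ + 1) * |(1 / n : ℝ)|) ^ n ≤ Real.exp (‖X‖ + 1) := by
      have := Real.add_one_le_exp ((‖X‖ + 1) * |(1 / n : ℝ)|)
      calc _ ≤ Real.exp ((‖X‖ + 1) * |(1 / n : ℝ)|) ^ n :=
            pow_le_pow_left₀ (by linarith) (by linarith) n
        _ = Real.exp (‖X‖ + 1) := by
            rw [← Real.exp_nat_mul, abs_of_pos (by positivity)]
            congr 1; field_simp
    calc _ = (1 + (‖X‖ + 1) * |(1 / n : ℝ)|) ^ n * (n * ‖F (1 / n) - E (1 / n)‖) := by ring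
      _ ≤ _ := mul_le_mul_of_nonneg_right h3 (by positivity)
  have hEn : Tendsto (fun n : ℕ => E (1 / n) ^ n) atTop (𝓝 (NormedSpace.exp X)) := by
    refine tendsto_const_nhds.congr' ?_
    filter_upwards [eventually_gt_atTop 0] with n hn
    have hn' : (n : ℝ) ≠ 0 := by exact_mod_cast hn.ne'
    let _ : NormedAlgebra ℚ 𝔸 := NormedAlgebra.restrictScalars ℚ ℝ 𝔸
    simp only [E]
    rw [← NormedSpace.exp_nsmul, ← Nat.cast_smul_eq_nsmul ℝ, smul_smul]
    simp [hn']
  simpa using hzero.add hEn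

/-- The Lie–Trotter product formula. -/
theorem tendsto_trotter (A B : 𝔸) :
    Tendsto (fun n : ℕ => (NormedSpace.exp ((1 / n : ℝ) • A) * NormedSpace.exp ((1 / n : ℝ) • B)) ^ n)
      atTop (𝓝 (NormedSpace.exp (A + B))) := by
  refine tendsto_pow_exp (F := fun h : ℝ => NormedSpace.exp (h • A) * NormedSpace.exp (h • B))
    (by simp) ?_
  simpa using! (hasDerivAt_exp_smul_zero A).fun_mul (hasDerivAt_exp_smul_zero B)

/-- Euler's limit transfers algebraic facts about `X`, such as an eigenvector or an annihilated
functional, to its exponential. -/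
theorem tendsto_one_add_pow_exp (X : 𝔸) :
    Tendsto (fun n : ℕ => (1 + (1 / n : ℝ) • X) ^ n) atTop (𝓝 (NormedSpace.exp X)) := by
  refine tendsto_pow_exp (F := fun h : ℝ => 1 + h • X) (by simp) ?_
  simpa using ((hasDerivAt_id (0 : ℝ)).smul_const X).const_add 1

end Chernoff

/-! ### Exponentials on eigenvectors. -/

section Exp

variable {E : Type*} [NormedAddCommGroup E] [NormedSpace ℂ E] [CompleteSpace E] [Nontrivial E]

/-- The exponential of an operator acts on an eigenvector by the exponential of the eigenvalue. -/
theorem exp_apply_eigenvector {X : E →L[ℂ] E} {v : E} {c : ℂ} (h : X v = c • v) :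
    NormedSpace.exp X v = Complex.exp c • v := by
  have h1 : Tendsto (fun n : ℕ => ((1 + (1 / n : ℝ) • X) ^ n) v) atTop
      (𝓝 (NormedSpace.exp X v)) :=
    ((ContinuousLinearMap.apply ℂ E v).continuous.tendsto _).comp (tendsto_one_add_pow_exp X)
  have h2 : Tendsto (fun n : ℕ => ((1 + (1 / n : ℝ) • c) ^ n) • v) atTop
      (𝓝 (Complex.exp c • v)) := by
    rw [Complex.exp_eq_exp_ℂ]
    exact (tendsto_one_add_pow_exp c).smul_const v
  refine tendsto_nhds_unique h1 (h2.congr fun n => ?_)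
  have key : ∀ m : ℕ, ((1 + (1 / n : ℝ) • X) ^ m) v = ((1 + (1 / n : ℝ) • c) ^ m) • v := by
    intro m
    induction m with
    | zero => simp
    | succ m ih =>
      rw [pow_succ', mul_apply_eq_comp, ih, map_smul, pow_succ, mul_smul]
      congr 1
      have e : (1 / n : ℝ) • X v = ((1 / n : ℝ) • c) • v := by rw [h, smul_assoc]
      rw [add_smul, one_smul, ← e]
      rfl
  exact (key n).symm

end Exp

/-! ### The closed semigroup of evolutions and its unitary controllability. -/

section ClosedChan

variable {n : Type*} [Fintype n] [DecidableEq n]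

theorem conj_mul (U V : Matrix n n ℂ) : conj (U * V) = conj U * conj V := by
  ext1 ρ
  rw [mul_apply_eq_comp, conj_apply, conj_apply, conj_apply, Matrix.conjTranspose_mul]
  simp only [Matrix.mul_assoc]

theorem conj_one : conj (1 : Matrix n n ℂ) = 1 := by
  ext1 ρ
  simp [conj_apply]

theorem conj_smul_of_norm_eq_one {c : ℂ} (hc : ‖c‖ = 1) (U : Matrix n n ℂ) :
    conj (c • U) = conj U := by
  ext1 ρ
  rw [conj_apply, conj_apply, Matrix.conjTranspose_smul]
  have h : star c * c = 1 := by
    rw [Complex.star_def, mul_comm, Complex.mul_conj, Complex.normSq_eq_norm_sq, hc]; simp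
  rw [Matrix.smul_mul, Matrix.mul_smul, Matrix.smul_mul, smul_smul, h, one_smul]

theorem continuous_conj : Continuous (conj : Matrix n n ℂ → Superop n) := by
  have h : Continuous fun U : Matrix n n ℂ => Uᴴ := continuous_star
  unfold conj
  fun_prop

variable {S : Set (Matrix n n ℂ)}

theorem mul_mem_closedChan {Φ Ψ : Superop n} (hΦ : Φ ∈ closedChan S) (hΨ : Ψ ∈ closedChan S) :
    Φ * Ψ ∈ closedChan S :=
  map_mem_closure₂ continuous_mul hΦ hΨ fun a ha b hb => Chan.comp a b ha hb

theorem isClosed_closedChan : IsClosed (closedChan S) := isClosed_closure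

theorem one_mem_closedChan : (1 : Superop n) ∈ closedChan S := by
  refine subset_closure ?_
  have := Chan.unitary (S := S) 0 Matrix.isHermitian_zero (by simp) 0 le_rfl
  simpa [conj_one] using this

theorem jump_mem_closedChan {a : Matrix n n ℂ} (ha : a ∈ S) {t : ℝ} (ht : 0 ≤ t) :
    NormedSpace.exp ((t : ℂ) • lindblad a) ∈ closedChan S :=
  subset_closure (Chan.jump a ha t ht)

theorem conj_pow_mem_closedChan {U : Matrix n n ℂ} (h : conj U ∈ closedChan S) (m : ℕ) :
    conj (U ^ m) ∈ closedChan S := by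
  induction m with
  | zero => simpa [conj_one] using one_mem_closedChan
  | succ m ih => rw [pow_succ, conj_mul]; exact mul_mem_closedChan ih h

/-- The matrices whose one-parameter group acts by conjugations in the closed class. -/
def flows (S : Set (Matrix n n ℂ)) : Set (Matrix n n ℂ) :=
  {A | ∀ t : ℝ, conj (NormedSpace.exp (t • A)) ∈ closedChan S}

/-- Closedness is what lets derivatives of curves in `flows`, and hence brackets, stay in `flows`.
-/
theorem isClosed_flows : IsClosed (flows S) := by
  have : flows S = ⋂ t : ℝ, (fun A => conj (NormedSpace.exp (t • A))) ⁻¹' closedChan S := by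
    ext A; simp [flows]
  rw [this]
  refine isClosed_iInter fun t => isClosed_closedChan.preimage (continuous_conj.comp ?_)
  let _ : NormedAlgebra ℚ (Matrix n n ℂ) := NormedAlgebra.restrictScalars ℚ ℂ _
  exact NormedSpace.exp_continuous.comp (continuous_const_smul t)

theorem smul_mem_flows {A : Matrix n n ℂ} (hA : A ∈ flows S) (r : ℝ) : r • A ∈ flows S := by
  intro t
  rw [smul_smul]
  exact hA _

theorem add_mem_flows [Nonempty n] {A B : Matrix n n ℂ} (hA : A ∈ flows S) (hB : B ∈ flows S) :
    A + B ∈ flows S := by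
  intro t
  rw [smul_add]
  refine isClosed_closedChan.mem_of_tendsto
    ((continuous_conj.tendsto _).comp (tendsto_trotter (t • A) (t • B)))
    (Eventually.of_forall fun m => conj_pow_mem_closedChan ?_ m)
  rw [conj_mul]
  exact mul_mem_closedChan (smul_mem_flows hA t _) (smul_mem_flows hB t _)

/-- The exponential commutes with similarity, so the flow of the conjugate is a product of three
available flows. The backward flow of `A` is needed, which is why `flows` asks for all real times.
-/
theorem conj_exp_mem_flows {A B : Matrix n n ℂ} (hA : A ∈ flows S) (hB : B ∈ flows S) (t : ℝ) :
    NormedSpace.exp (t • A) * B * NormedSpace.exp ((-t) • A) ∈ flows S := by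
  intro s
  have hinv : NormedSpace.exp ((-t) • A) = (NormedSpace.exp (t • A))⁻¹ := by
    rw [neg_smul, Matrix.exp_neg]
  have : NormedSpace.exp (s • (NormedSpace.exp (t • A) * B * NormedSpace.exp ((-t) • A)))
      = NormedSpace.exp (t • A) * NormedSpace.exp (s • B) * NormedSpace.exp ((-t) • A) := by
    rw [hinv, ← Matrix.exp_conj _ _ (Matrix.isUnit_exp _), Matrix.mul_smul, Matrix.smul_mul]
  rw [this, conj_mul, conj_mul]
  exact mul_mem_closedChan (mul_mem_closedChan (hA t) (hB s)) (hA (-t))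

/-- The bracket is the derivative at `0` of `e^{tA} B e^{-tA}`. The difference quotients are real
combinations of members of `flows`, so their limit is a member too. -/
theorem lie_mem_flows [Nonempty n] {A B : Matrix n n ℂ} (hA : A ∈ flows S) (hB : B ∈ flows S) :
    ⁅A, B⁆ ∈ flows S := by
  have h1 := hasDerivAt_exp_smul_zero A
  have h2 : HasDerivAt (fun t : ℝ => NormedSpace.exp ((-t) • A)) (-A) 0 := by
    simpa using hasDerivAt_exp_smul_zero (-A)
  have h3 := (h1.fun_mul (hasDerivAt_const (0 : ℝ) B)).fun_mul h2
  have h4 : HasDerivAt (fun t : ℝ => NormedSpace.exp (t • A) * B * NormedSpace.exp ((-t) • A))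
      ⁅A, B⁆ 0 := by
    convert! h3 using 1
    simp [LieRing.of_associative_ring_bracket, sub_eq_add_neg]
  refine isClosed_flows.mem_of_tendsto (hasDerivAt_iff_tendsto_slope.1 h4)
    (Eventually.of_forall fun t => ?_)
  rw [slope_def_module]
  refine smul_mem_flows ?_ _
  rw [sub_eq_add_neg]
  refine add_mem_flows (conj_exp_mem_flows hA hB t) ?_
  simpa using smul_mem_flows hB (-1)

theorem antiHermitianSpan_subset_flows : antiHermitianSpan S ⊆ flows S := by
  have key : ∀ A ∈ antiHermitianSpan S, ∀ t : ℝ, 0 ≤ t →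
      conj (NormedSpace.exp (t • A)) ∈ closedChan S := by
    rintro A ⟨hA, hA'⟩ t ht
    have hI : Complex.I • (-Complex.I) • A = A := by simp [smul_smul]
    have := Chan.unitary (S := S) ((-Complex.I) • A)
      (by simp [Matrix.IsHermitian, Matrix.conjTranspose_smul, hA']) (by rwa [hI]) t ht
    rw [mul_smul, hI] at this
    exact subset_closure this
  intro A hA t
  -- Negative times cost nothing: running `A` backwards is running `-A` forwards, and the
  -- anti-Hermitian span is symmetric.
  rcases le_total 0 t with ht | ht
  · exact key A hA t ht
  · have := key (-A) ⟨neg_mem hA.1, by rw [Matrix.conjTranspose_neg, hA.2]⟩ (-t) (by linarith)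
    simpa using this

theorem su_subset_flows [Nonempty n] (hS : GeneratesHormander S) : su n ⊆ flows S := by
  intro A hA
  refine LieSubalgebra.lieSpan_induction (p := fun x _ => x ∈ flows S) ℝ
    (fun x hx => antiHermitianSpan_subset_flows hx) ?_ (fun _ _ _ _ hx hy => add_mem_flows hx hy)
    (fun a _ _ hx => smul_mem_flows hx a) (fun _ _ _ _ hx hy => lie_mem_flows hx hy) (hS hA)
  intro t
  simpa [conj_one] using one_mem_closedChan

/-- A unitary matrix is, up to a phase, the exponential of an anti-Hermitian matrix. -/
theorem exists_exp_eq_smul_unitary {U : Matrix n n ℂ} (hU : U ∈ Matrix.unitaryGroup n ℂ) :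
    ∃ (c : ℂ) (H : Matrix n n ℂ), ‖c‖ = 1 ∧ H.IsHermitian ∧
      NormedSpace.exp (Complex.I • H) = c • U := by
  -- The spectrum is finite, so some angle in `(0, 1)` is the argument of no eigenvalue. Multiplying
  -- by `-z⁻¹` moves this gap to `-1`, and the principal logarithm of the rotated unitary exists.
  obtain ⟨θ, hθ, hθ'⟩ := (Set.Ioo_infinite (zero_lt_one' ℝ)).exists_notMem_finite
    ((Matrix.finite_spectrum U).image Complex.arg)
  have hz : Complex.exp (θ * Complex.I) ∉ spectrum ℂ U := by
    intro h
    refine hθ' ⟨_, h, ?_⟩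
    rw [Complex.arg_exp_mul_I, toIocMod_eq_self]
    have := Real.pi_gt_three
    constructor <;> linarith [hθ.1, hθ.2]
  set z := Complex.exp (θ * Complex.I) with hzdef
  have hz1 : ‖z‖ = 1 := Complex.norm_exp_ofReal_mul_I θ
  have hz0 : z ≠ 0 := by rw [← norm_pos_iff, hz1]; exact one_pos
  have hc1 : ‖-z⁻¹‖ = 1 := by simp [hz1]
  have hstar : star (-z⁻¹) * (-z⁻¹) = 1 := by
    rw [Complex.star_def, mul_comm, Complex.mul_conj, Complex.normSq_eq_norm_sq, hc1]; simp
  have hV : (-z⁻¹) • U ∈ unitary (Matrix n n ℂ) := by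
    have h1 := Unitary.mem_iff.1 hU
    rw [Unitary.mem_iff, star_smul]
    constructor
    · rw [Matrix.smul_mul, Matrix.mul_smul, smul_smul, hstar, one_smul, h1.1]
    · rw [Matrix.smul_mul, Matrix.mul_smul, smul_smul, mul_comm, hstar, one_smul, h1.2]
  have hspec : (-1 : ℂ) ∉ spectrum ℂ ((-z⁻¹) • U) := by
    have := spectrum.unit_smul_eq_smul U (Units.mk0 (-z⁻¹) (by simpa using hz0))
    rw [show (Units.mk0 (-z⁻¹) (by simpa using hz0) : ℂˣ) • U = (-z⁻¹) • U from rfl] at this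
    rw [this]
    rintro ⟨w, hw, hw'⟩
    have h2 : -z⁻¹ * w = -1 := hw'
    apply hz
    have : w = z := by
      field_simp at h2
      linear_combination -h2
    rwa [← this]
  have hlt := (Unitary.norm_sub_one_lt_two_iff hV).2 hspec
  have := expUnitary_argSelfAdjoint (u := ⟨_, hV⟩) hlt
  refine ⟨-z⁻¹, (Unitary.argSelfAdjoint ⟨_, hV⟩ : Matrix n n ℂ), hc1,
    (Unitary.argSelfAdjoint _).2, ?_⟩
  have h3 := congrArg (Subtype.val) this
  rwa [selfAdjoint.expUnitary_coe] at h3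

/-- A Hörmander system controls all unitary conjugations. -/
theorem conj_mem_closedChan [Nonempty n] (hS : GeneratesHormander S) {U : Matrix n n ℂ}
    (hU : U ∈ Matrix.unitaryGroup n ℂ) : conj U ∈ closedChan S := by
  obtain ⟨c, H, hc, hH, hexp⟩ := exists_exp_eq_smul_unitary hU
  have hN : (Fintype.card n : ℝ) ≠ 0 := by exact_mod_cast Fintype.card_ne_zero
  have htr : H.trace = (H.trace.re : ℂ) := by
    have : star H.trace = H.trace := by rw [← Matrix.trace_conjTranspose, hH]
    exact (Complex.conj_eq_iff_re.1 this).symm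
  -- The mean eigenvalue of `H`; subtracting it leaves a traceless generator, and the scalar part
  -- exponentiates to a phase.
  set τ : ℝ := H.trace.re / Fintype.card n with hτ
  set A : Matrix n n ℂ := Complex.I • (H - (τ : ℂ) • 1) with hA
  have hAsu : A ∈ su n := by
    constructor
    · rw [hA, Matrix.conjTranspose_smul, Matrix.conjTranspose_sub, Matrix.conjTranspose_smul, hH]
      simp
    · rw [hA, Matrix.trace_smul, Matrix.trace_sub, Matrix.trace_smul, Matrix.trace_one, htr, hτ]
      push_cast
      rw [smul_eq_mul, smul_eq_mul, div_mul_cancel₀ _ (by exact_mod_cast hN), sub_self, mul_zero]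
  have hsplit : Complex.I • H = A + algebraMap ℂ (Matrix n n ℂ) (τ * Complex.I) := by
    rw [hA, Algebra.algebraMap_eq_smul_one, smul_sub, smul_smul, mul_comm Complex.I]
    simp
  have h1 : conj U = conj (NormedSpace.exp A) := by
    rw [← conj_smul_of_norm_eq_one hc U, ← hexp, hsplit,
      Matrix.exp_add_of_commute _ _ (Algebra.commute_algebraMap_right _ _)]
    have : NormedSpace.exp (algebraMap ℂ (Matrix n n ℂ) (τ * Complex.I))
        = algebraMap ℂ (Matrix n n ℂ) (Complex.exp (τ * Complex.I)) := by
      rw [Complex.exp_eq_exp_ℂ]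
      exact (NormedSpace.algebraMap_exp_comm (𝕂 := ℂ) _).symm
    rw [this, Algebra.algebraMap_eq_smul_one, Matrix.mul_smul, mul_one,
      conj_smul_of_norm_eq_one (Complex.norm_exp_ofReal_mul_I τ)]
  rw [h1]
  simpa using su_subset_flows hS hAsu 1

end ClosedChan

/-! ### Evolutions preserve the densities. -/

section Positivity

variable {n : Type*} [Fintype n]

theorem isClosed_posSemidef : IsClosed {ρ : Matrix n n ℂ | ρ.PosSemidef} := by
  have hH : IsClosed {ρ : Matrix n n ℂ | ρᴴ = ρ} := isClosed_eq continuous_star continuous_id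
  have hP : IsClosed {ρ : Matrix n n ℂ | ∀ x : n → ℂ, 0 ≤ star x ⬝ᵥ (ρ *ᵥ x)} := by
    simp only [Set.ofPred_forall]
    refine isClosed_iInter fun x => isClosed_le continuous_const ?_
    fun_prop
  convert! hH.inter hP using 1
  ext ρ
  simp [Matrix.posSemidef_iff_dotProduct_mulVec, Matrix.IsHermitian]

theorem isClosed_densities : IsClosed (densities n) :=
  isClosed_posSemidef.inter (isClosed_eq (by fun_prop) continuous_const)

variable [DecidableEq n]

theorem conj_mem_densities {U ρ : Matrix n n ℂ} (hU : U ∈ Matrix.unitaryGroup n ℂ)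
    (hρ : ρ ∈ densities n) : conj U ρ ∈ densities n := by
  refine ⟨hρ.1.mul_mul_conjTranspose_same U, ?_⟩
  rw [conj_apply, Matrix.trace_mul_comm, ← Matrix.mul_assoc]
  have : Uᴴ * U = 1 := (Unitary.mem_iff.1 hU).1
  rw [this, one_mul, hρ.2]

theorem exp_mem_unitaryGroup {H : Matrix n n ℂ} (hH : H.IsHermitian) (t : ℝ) :
    NormedSpace.exp (((t : ℂ) * Complex.I) • H) ∈ Matrix.unitaryGroup n ℂ := by
  have h : (NormedSpace.exp (((t : ℂ) * Complex.I) • H))ᴴ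
      = (NormedSpace.exp (((t : ℂ) * Complex.I) • H))⁻¹ := by
    rw [← Matrix.exp_conjTranspose, ← Matrix.exp_neg, Matrix.conjTranspose_smul, hH]
    simp
  rw [Matrix.mem_unitaryGroup_iff, Matrix.star_eq_conjTranspose, h]
  exact Matrix.mul_nonsing_inv _ ((Matrix.isUnit_iff_isUnit_det _).1 (Matrix.isUnit_exp _))

theorem trace_lindblad (a ρ : Matrix n n ℂ) : (lindblad a ρ).trace = 0 := by
  rw [lindblad_apply, Matrix.trace_sub, Matrix.trace_sub, Matrix.trace_smul,
    Matrix.trace_mul_comm (a * ρ), Matrix.trace_mul_comm ρ, ← Matrix.mul_assoc, smul_eq_mul]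
  ring

theorem trace_exp_lindblad [Nonempty n] (a ρ : Matrix n n ℂ) (t : ℝ) :
    (NormedSpace.exp ((t : ℂ) • lindblad a) ρ).trace = ρ.trace := by
  have hc : Continuous fun Φ : Superop n => (Φ ρ).trace :=
    (continuous_id.matrix_trace).comp (ContinuousLinearMap.apply ℂ _ ρ).continuous
  refine tendsto_nhds_unique ((hc.tendsto _).comp (tendsto_one_add_pow_exp ((t : ℂ) • lindblad a)))
    (tendsto_const_nhds.congr fun m => ?_)
  have : ∀ j : ℕ, (((1 + (1 / m : ℝ) • (t : ℂ) • lindblad a) ^ j : Superop n) ρ).trace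
      = ρ.trace := by
    intro j
    induction j with
    | zero => simp
    | succ j ih =>
      rw [pow_succ', mul_apply_eq_comp, add_apply, smul_apply, smul_apply, one_apply_eq_self,
        Matrix.trace_add, Matrix.trace_smul, Matrix.trace_smul, trace_lindblad, ih]
      simp
  exact (this m).symm

/-- A first-order Kraus form of the jump semigroup. -/
theorem conj_add_conj_eq (a : Matrix n n ℂ) (h : ℝ) :
    conj (1 - h • (aᴴ * a)) + (2 * h) • conj a
      = 1 + h • lindblad a + (h ^ 2) • conj (aᴴ * a) := by
  ext1 ρ
  simp only [add_apply, smul_apply, conj_apply,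
    lindblad_apply, Matrix.conjTranspose_sub, Matrix.conjTranspose_one, Matrix.conjTranspose_smul,
    Matrix.conjTranspose_mul, Matrix.conjTranspose_conjTranspose, star_trivial, sub_mul, mul_sub,
    one_mul, mul_one, Matrix.smul_mul, Matrix.mul_smul, one_apply_eq_self]
  module

theorem posSemidef_exp_lindblad [Nonempty n] (a : Matrix n n ℂ) {ρ : Matrix n n ℂ}
    (hρ : ρ.PosSemidef) {t : ℝ} (ht : 0 ≤ t) :
    (NormedSpace.exp ((t : ℂ) • lindblad a) ρ).PosSemidef := by
  -- For `h * t ≥ 0` this is a sum of positive maps, and its velocity at `0` is `t • lindblad a`: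
  -- the first-order Kraus form has only a quadratic error. Chernoff's formula then carries
  -- positivity to the semigroup.
  let F : ℝ → Superop n := fun h => conj (1 - (h * t) • (aᴴ * a)) + (2 * (h * t)) • conj a
  have hz : ∀ Φ : Superop n, (0 : ℝ) • Φ = 0 := fun Φ => by
    ext1 σ
    rw [smul_apply, zero_smul]
    rfl
  have hF : HasDerivAt F ((t : ℂ) • lindblad a) 0 := by
    have e : F = fun h => 1 + (h * t) • lindblad a + ((h * t) ^ 2) • conj (aᴴ * a) :=
      funext fun h => conj_add_conj_eq a _
    rw [e]
    have h1 : HasDerivAt (fun h : ℝ => h * t) t 0 := by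
      simpa using (hasDerivAt_id (0 : ℝ)).mul_const t
    have h2 : HasDerivAt (fun h : ℝ => (h * t) ^ 2) 0 0 := by simpa using! h1.fun_pow 2
    have h3 := ((h1.smul_const (lindblad a)).const_add 1).fun_add (h2.smul_const (conj (aᴴ * a)))
    convert! h3 using 1
    rw [hz, add_zero]
    rfl
  have hF0 : F 0 = 1 := by simp [F, conj_one, hz]
  refine isClosed_posSemidef.mem_of_tendsto
    (((ContinuousLinearMap.apply ℂ _ ρ).continuous.tendsto _).comp (tendsto_pow_exp hF0 hF))
    (Eventually.of_forall fun m => ?_)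
  have hm : 0 ≤ (1 / m : ℝ) * t := by positivity
  have : ∀ j : ℕ, (((F (1 / m)) ^ j : Superop n) ρ).PosSemidef := by
    intro j
    induction j with
    | zero => simpa using hρ
    | succ j ih =>
      rw [pow_succ', mul_apply_eq_comp]
      refine (ih.mul_mul_conjTranspose_same _).add ?_
      exact (ih.mul_mul_conjTranspose_same a).smul (by positivity : 0 ≤ 2 * ((1 / m : ℝ) * t))
  exact this m

/-- Every operation of the closed class preserves the densities. -/
theorem closedChan_mapsTo_densities [Nonempty n] {S : Set (Matrix n n ℂ)} {Φ : Superop n}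
    (hΦ : Φ ∈ closedChan S) {ρ : Matrix n n ℂ} (hρ : ρ ∈ densities n) : Φ ρ ∈ densities n := by
  have key : ∀ Ψ : Superop n, Chan S Ψ → ∀ σ ∈ densities n, Ψ σ ∈ densities n := by
    intro Ψ hΨ
    induction hΨ with
    | unitary H hH hS t ht => exact fun σ hσ => conj_mem_densities (exp_mem_unitaryGroup hH t) hσ
    | jump a ha t ht =>
      exact fun σ hσ => ⟨posSemidef_exp_lindblad a hσ.1 ht, by rw [trace_exp_lindblad, hσ.2]⟩
    | comp Φ Ψ _ _ h1 h2 => exact fun σ hσ => h1 _ (h2 σ hσ)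
  have hcl : IsClosed {Ψ : Superop n | Ψ ρ ∈ densities n} :=
    isClosed_densities.preimage (ContinuousLinearMap.apply ℂ _ ρ).continuous
  exact closure_minimal (fun Ψ hΨ => key Ψ hΨ ρ hρ) hcl hΦ

end Positivity

/-! ### Superoperators determined by matrix units. -/

section Superop

variable {n : Type*} [Fintype n] [DecidableEq n]

theorem superop_ext {Φ Ψ : Superop n}
    (h : ∀ x y, Φ (Matrix.single x y 1) = Ψ (Matrix.single x y 1)) : Φ = Ψ := by
  ext1 ρ
  rw [Matrix.matrix_eq_sum_single ρ]
  simp only [map_sum]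
  refine Finset.sum_congr rfl fun x _ => Finset.sum_congr rfl fun y _ => ?_
  have : Matrix.single x y (ρ x y) = ρ x y • Matrix.single x y (1 : ℂ) := by
    rw [Matrix.smul_single, smul_eq_mul, mul_one]
  rw [this, map_smul, map_smul, h]

/-- Superoperators converge as soon as they do on the matrix units. -/
theorem tendsto_superop {ι : Type*} {l : Filter ι} {F : ι → Superop n} {Φ : Superop n}
    (h : ∀ x y, Tendsto (fun t => F t (Matrix.single x y 1)) l (𝓝 (Φ (Matrix.single x y 1)))) :
    Tendsto F l (𝓝 Φ) := by
  let T : Superop n →ₗ[ℂ] (n → n → Matrix n n ℂ) :=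
    { toFun := fun Ψ x y => Ψ (Matrix.single x y 1)
      map_add' := fun _ _ => rfl
      map_smul' := fun _ _ => rfl }
  -- An injective linear map from a finite-dimensional space is a closed embedding, so convergence
  -- may be tested after evaluation on matrix units.
  have hT : LinearMap.ker T = ⊥ := by
    rw [LinearMap.ker_eq_bot]
    exact fun Φ Ψ h => superop_ext fun x y => congrFun (congrFun h x) y
  rw [(LinearMap.isClosedEmbedding_of_injective hT).isEmbedding.tendsto_nhds_iff]
  exact tendsto_pi_nhds.2 fun x => tendsto_pi_nhds.2 fun y => h x y

end Superop

/-! ### Tensor products of matrices and superoperators, swaps, and one-qubit generators. -/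

section Tensor

variable {k : ℕ}

theorem tensor_mul (A B : Fin k → Matrix (Fin 2) (Fin 2) ℂ) :
    tensor A * tensor B = tensor fun j => A j * B j := by
  ext x y
  simp only [Matrix.mul_apply, tensor, Matrix.of_apply, ← Finset.prod_mul_distrib]
  rw [Fintype.prod_sum]

theorem tensor_conjTranspose (A : Fin k → Matrix (Fin 2) (Fin 2) ℂ) :
    (tensor A)ᴴ = tensor fun j => (A j)ᴴ := by
  ext x y
  simp [tensor, Matrix.conjTranspose_apply]

theorem prod_boole_eq (x y : Bits k) :
    ∏ j, (if x j = y j then (1 : ℂ) else 0) = if x = y then 1 else 0 := by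
  simp [Finset.prod_ite_zero, funext_iff]

theorem tensor_one : tensor (fun _ : Fin k => (1 : Matrix (Fin 2) (Fin 2) ℂ)) = 1 := by
  ext x y
  simp only [tensor, Matrix.of_apply, Matrix.one_apply, prod_boole_eq]

theorem tensor_single (x y : Bits k) :
    tensor (fun j => Matrix.single (x j) (y j) (1 : ℂ)) = Matrix.single x y 1 := by
  ext u v
  simp only [tensor, Matrix.of_apply, Matrix.single_apply]
  rw [Finset.prod_ite_zero]
  simp [funext_iff, forall_and]

theorem zeroState_eq_tensor :
    zeroState k = tensor fun _ : Fin k => Matrix.single 0 0 1 :=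
  (tensor_single (fun _ => 0) fun _ => 0).symm

/-- The matrix `σ₁ ⊗ ⋯ ⊗ X ⊗ ⋯ ⊗ σ_k` as a function of the factor `X` in register `i`. -/
def insertAt (σ : Fin k → Matrix (Fin 2) (Fin 2) ℂ) (i : Fin k) :
    Matrix (Fin 2) (Fin 2) ℂ →ₗ[ℂ] Matrix (Bits k) (Bits k) ℂ where
  toFun X := tensor (Function.update σ i X)
  map_add' X Y := by
    ext x y
    simp only [tensor, Matrix.of_apply, Matrix.add_apply,
      ← Finset.mul_prod_erase _ _ (Finset.mem_univ i), Function.update_self, add_mul]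
    congr 2 <;> exact Finset.prod_congr rfl fun j hj => by
      simp [Function.update_of_ne (Finset.ne_of_mem_erase hj)]
  map_smul' c X := by
    ext x y
    simp only [tensor, Matrix.of_apply, Matrix.smul_apply, RingHom.id_apply, smul_eq_mul,
      ← Finset.mul_prod_erase _ _ (Finset.mem_univ i), Function.update_self, mul_assoc]
    congr 2
    exact Finset.prod_congr rfl fun j hj => by
      simp [Function.update_of_ne (Finset.ne_of_mem_erase hj)]

theorem insertAt_apply (σ : Fin k → Matrix (Fin 2) (Fin 2) ℂ) (i : Fin k)
    (X : Matrix (Fin 2) (Fin 2) ℂ) : insertAt σ i X = tensor (Function.update σ i X) := rfl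

theorem insertAt_self (σ : Fin k → Matrix (Fin 2) (Fin 2) ℂ) (i : Fin k) :
    insertAt σ i (σ i) = tensor σ := by
  rw [insertAt_apply, Function.update_eq_self]

theorem onRegister_mul_insertAt (σ : Fin k → Matrix (Fin 2) (Fin 2) ℂ) (i : Fin k)
    (A X : Matrix (Fin 2) (Fin 2) ℂ) :
    onRegister i A * insertAt σ i X = insertAt σ i (A * X) := by
  rw [onRegister, insertAt_apply, insertAt_apply, tensor_mul]
  congr 1
  ext1 j
  rcases eq_or_ne j i with rfl | h
  · simp
  · simp [Function.update_of_ne h]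

theorem insertAt_mul_onRegister (σ : Fin k → Matrix (Fin 2) (Fin 2) ℂ) (i : Fin k)
    (A X : Matrix (Fin 2) (Fin 2) ℂ) :
    insertAt σ i X * onRegister i A = insertAt σ i (X * A) := by
  rw [onRegister, insertAt_apply, insertAt_apply, tensor_mul]
  congr 1
  ext1 j
  rcases eq_or_ne j i with rfl | h
  · simp
  · simp [Function.update_of_ne h]

theorem onRegister_conjTranspose (i : Fin k) (A : Matrix (Fin 2) (Fin 2) ℂ) :
    (onRegister i A)ᴴ = onRegister i Aᴴ := by
  rw [onRegister, onRegister, tensor_conjTranspose]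
  congr 1
  ext1 j
  rcases eq_or_ne j i with rfl | h
  · simp
  · simp [Function.update_of_ne h]

theorem conj_onRegister_insertAt (σ : Fin k → Matrix (Fin 2) (Fin 2) ℂ) (i : Fin k)
    (U X : Matrix (Fin 2) (Fin 2) ℂ) :
    conj (onRegister i U) (insertAt σ i X) = insertAt σ i (U * X * Uᴴ) := by
  rw [conj_apply, onRegister_conjTranspose, onRegister_mul_insertAt, insertAt_mul_onRegister]

theorem lindblad_onRegister_insertAt (σ : Fin k → Matrix (Fin 2) (Fin 2) ℂ) (i : Fin k)
    (a X : Matrix (Fin 2) (Fin 2) ℂ) :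
    lindblad (onRegister i a) (insertAt σ i X) = insertAt σ i (lindblad a X) := by
  -- `onRegister i a` is itself an `insertAt`, with identities in the other registers.
  have h : onRegister i aᴴ * onRegister i a = onRegister i (aᴴ * a) :=
    onRegister_mul_insertAt _ i _ _
  rw [lindblad_apply, lindblad_apply, onRegister_conjTranspose, h, map_sub, map_sub, map_smul]
  simp only [onRegister_mul_insertAt, insertAt_mul_onRegister]

theorem onRegister_mem_unitaryGroup (i : Fin k) {U : Matrix (Fin 2) (Fin 2) ℂ}
    (hU : U ∈ Matrix.unitaryGroup (Fin 2) ℂ) :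
    onRegister i U ∈ Matrix.unitaryGroup (Bits k) ℂ := by
  rw [Matrix.mem_unitaryGroup_iff, Matrix.star_eq_conjTranspose] at *
  rw [onRegister_conjTranspose]
  have h : onRegister i U * onRegister i Uᴴ = onRegister i (U * Uᴴ) :=
    onRegister_mul_insertAt _ i _ _
  rw [h, hU, onRegister, Function.update_eq_self_iff.2 rfl, tensor_one]

/-- The other registers are spectators, so the `k`-qubit semigroup is governed by the spectrum of a
one-qubit generator. -/
theorem exp_lindblad_insertAt {a X : Matrix (Fin 2) (Fin 2) ℂ} {c : ℂ}
    (h : lindblad a X = c • X) (σ : Fin k → Matrix (Fin 2) (Fin 2) ℂ) (i : Fin k) (t : ℝ) :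
    NormedSpace.exp ((t : ℂ) • lindblad (onRegister i a)) (insertAt σ i X)
      = Complex.exp (t * c) • insertAt σ i X := by
  refine exp_apply_eigenvector ?_
  rw [smul_apply, lindblad_onRegister_insertAt, h, map_smul, smul_smul]

/-- The permutation of the computational basis that exchanges the registers `i` and `j`. -/
def swapBits (i j : Fin k) : Equiv.Perm (Bits k) :=
  Equiv.arrowCongr (Equiv.swap i j) (Equiv.refl _)

/-- The unitary that exchanges the registers `i` and `j`. -/
def swapGate (i j : Fin k) : Matrix (Bits k) (Bits k) ℂ :=
  (swapBits i j).permMatrix ℂ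

theorem swapGate_mem_unitaryGroup (i j : Fin k) :
    swapGate i j ∈ Matrix.unitaryGroup (Bits k) ℂ := by
  rw [Matrix.mem_unitaryGroup_iff, Matrix.star_eq_conjTranspose, swapGate,
    Matrix.conjTranspose_permMatrix, ← Matrix.permMatrix_mul, inv_mul_cancel,
    Matrix.permMatrix_one]

theorem conj_swapGate_tensor (i j : Fin k) (A : Fin k → Matrix (Fin 2) (Fin 2) ℂ) :
    conj (swapGate i j) (tensor A) = tensor (A ∘ Equiv.swap i j) := by
  rw [conj_apply, swapGate, Matrix.conjTranspose_permMatrix, Equiv.Perm.permMatrix,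
    Equiv.Perm.permMatrix, PEquiv.toMatrix_toPEquiv_mul, PEquiv.mul_toMatrix_toPEquiv]
  ext x y
  simp only [tensor, Matrix.submatrix_apply, Matrix.of_apply, id, Function.comp]
  refine (Equiv.prod_comp (Equiv.swap i j) _).symm.trans ?_
  refine Finset.prod_congr rfl fun l _ => ?_
  have h1 : swapBits i j x (Equiv.swap i j l) = x l := by simp [swapBits, Equiv.arrowCongr]
  have h2 : (swapBits i j)⁻¹.symm y (Equiv.swap i j l) = y l := by
    rw [Equiv.Perm.inv_def, Equiv.symm_symm]; simp [swapBits, Equiv.arrowCongr]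
  rw [h1, h2]

theorem tensorSuperop_single
    (Φ : Fin k → (Matrix (Fin 2) (Fin 2) ℂ →ₗ[ℂ] Matrix (Fin 2) (Fin 2) ℂ)) (x y : Bits k) :
    tensorSuperop Φ (Matrix.single x y 1) = tensor fun j => Φ j (Matrix.single (x j) (y j) 1) := by
  have h : ∀ u v : Bits k, (Matrix.single x y (1 : ℂ)) u v
      • tensor (fun j => Φ j (Matrix.single (u j) (v j) 1))
      = if x = u then if y = v then tensor (fun j => Φ j (Matrix.single (u j) (v j) 1)) else 0
        else 0 := by
    intro u v
    rw [Matrix.single_apply]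
    split_ifs <;> simp_all
  simp [tensorSuperop, h]

theorem tensorSuperop_tensor
    (Φ : Fin k → (Matrix (Fin 2) (Fin 2) ℂ →ₗ[ℂ] Matrix (Fin 2) (Fin 2) ℂ))
    (A : Fin k → Matrix (Fin 2) (Fin 2) ℂ) :
    tensorSuperop Φ (tensor A) = tensor fun j => Φ j (A j) := by
  have hΦ : ∀ j, Φ j (A j) = ∑ p : Fin 2 × Fin 2, A j p.1 p.2 • Φ j (Matrix.single p.1 p.2 1) := by
    intro j
    conv_lhs => rw [Matrix.matrix_eq_sum_single (A j)]
    rw [Fintype.sum_prod_type]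
    simp only [map_sum]
    refine Finset.sum_congr rfl fun x _ => Finset.sum_congr rfl fun y _ => ?_
    rw [← map_smul, Matrix.smul_single, smul_eq_mul, mul_one]
  have h : tensorSuperop Φ (tensor A) = ∑ p : Bits k × Bits k, tensor A p.1 p.2
      • tensor fun j => Φ j (Matrix.single (p.1 j) (p.2 j) 1) := by
    rw [Fintype.sum_prod_type]
    simp [tensorSuperop]
  rw [h]
  ext u v
  simp only [hΦ]
  rw [Matrix.sum_apply]
  simp only [tensor, Matrix.of_apply, Matrix.smul_apply, Matrix.sum_apply, smul_eq_mul,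
    ← Finset.prod_mul_distrib]
  rw [Fintype.prod_sum]
  -- A string of pairs of bits is the same as a pair of strings.
  exact (Equiv.sum_comp (Equiv.arrowProdEquivProdArrow (Fin k) (fun _ => Fin 2) fun _ => Fin 2)
    (fun p : Bits k × Bits k => ∏ j, A j (p.1 j) (p.2 j)
      * Φ j (Matrix.single (p.1 j) (p.2 j) 1) (u j) (v j))).symm

theorem tensorSuperop_mul
    (Φ Ψ : Fin k → (Matrix (Fin 2) (Fin 2) ℂ →ₗ[ℂ] Matrix (Fin 2) (Fin 2) ℂ)) :
    tensorSuperop Φ * tensorSuperop Ψ = tensorSuperop fun j => Φ j ∘ₗ Ψ j := by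
  refine superop_ext fun x y => ?_
  rw [mul_apply_eq_comp, ← tensor_single, tensorSuperop_tensor, tensorSuperop_tensor,
    tensorSuperop_tensor]
  rfl

theorem tensorSuperop_id :
    tensorSuperop (fun _ : Fin k => (LinearMap.id : Matrix (Fin 2) (Fin 2) ℂ →ₗ[ℂ] _)) = 1 := by
  refine superop_ext fun x y => ?_
  rw [← tensor_single, tensorSuperop_tensor]
  rfl

theorem conj_swapGate_tensorSuperop (i j : Fin k)
    (Φ : Fin k → (Matrix (Fin 2) (Fin 2) ℂ →ₗ[ℂ] Matrix (Fin 2) (Fin 2) ℂ)) :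
    conj (swapGate i j) * tensorSuperop Φ * conj (swapGate i j)
      = tensorSuperop (Φ ∘ Equiv.swap i j) := by
  refine superop_ext fun x y => ?_
  rw [mul_apply_eq_comp, mul_apply_eq_comp, ← tensor_single, conj_swapGate_tensor,
    tensorSuperop_tensor, conj_swapGate_tensor, tensorSuperop_tensor]
  congr 1
  ext1 l
  simp

/-- The reset of one qubit to `|0⟩⟨0|`. -/
def reset : Matrix (Fin 2) (Fin 2) ℂ →ₗ[ℂ] Matrix (Fin 2) (Fin 2) ℂ :=
  (Matrix.traceLinearMap (Fin 2) ℂ ℂ).smulRight (Matrix.single 0 0 1)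

theorem reset_single (a b : Fin 2) :
    reset (Matrix.single a b 1) = if a = b then Matrix.single 0 0 1 else 0 := by
  split_ifs with h
  · subst h; simp [reset]
  · simp [reset, Matrix.trace_single_eq_of_ne, h]

theorem dephase_single (a b : Fin 2) :
    dephase (Matrix.single a b 1) = if a = b then Matrix.single a b 1 else 0 := by
  ext u v
  split_ifs with h
  · subst h
    by_cases huv : u = v
    · simp [dephase, huv]
    · simp only [dephase, LinearMap.coe_mk, AddHom.coe_mk, Matrix.diagonal_apply_ne _ huv]
      rw [Matrix.single_apply_of_ne]
      rintro ⟨rfl, rfl⟩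
      exact huv rfl
  · by_cases huv : u = v
    · subst huv
      simp only [dephase, LinearMap.coe_mk, AddHom.coe_mk, Matrix.diagonal_apply_eq,
        Matrix.zero_apply]
      rw [Matrix.single_apply_of_ne]
      rintro ⟨rfl, rfl⟩
      exact h rfl
    · simp [dephase, huv]

theorem lindblad_pauliZ (X : Matrix (Fin 2) (Fin 2) ℂ) :
    lindblad pauliZ X = !![0, -4 * X 0 1; -4 * X 1 0, 0] := by
  have h : pauliZᴴ = !![1, 0; 0, -1] := by
    ext u v; fin_cases u <;> fin_cases v <;> simp [pauliZ]
  rw [lindblad_apply, h, pauliZ]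
  conv_lhs => rw [Matrix.eta_fin_two X]
  ext u v
  fin_cases u <;> fin_cases v <;> simp <;> ring

theorem lindblad_lowering (X : Matrix (Fin 2) (Fin 2) ℂ) :
    lindblad lowering X = !![2 * X 1 1, -X 0 1; -X 1 0, -2 * X 1 1] := by
  have h : loweringᴴ = !![0, 0; 1, 0] := by
    ext u v; fin_cases u <;> fin_cases v <;> simp [lowering]
  rw [lindblad_apply, h, lowering]
  conv_lhs => rw [Matrix.eta_fin_two X]
  ext u v
  fin_cases u <;> fin_cases v <;> (simp; try ring)

theorem lindblad_pauliZ_single (a b : Fin 2) :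
    lindblad pauliZ (Matrix.single a b 1)
      = (if a = b then (0 : ℂ) else -4) • Matrix.single a b 1 := by
  rw [lindblad_pauliZ]
  ext u v
  fin_cases a <;> fin_cases b <;> fin_cases u <;> fin_cases v <;> simp

theorem lindblad_lowering_single_zero_zero :
    lindblad lowering (Matrix.single 0 0 1) = (0 : ℂ) • Matrix.single 0 0 1 := by
  rw [lindblad_lowering]
  ext u v
  fin_cases u <;> fin_cases v <;> simp

theorem lindblad_lowering_single_of_ne {a b : Fin 2} (h : a ≠ b) :
    lindblad lowering (Matrix.single a b 1) = (-1 : ℂ) • Matrix.single a b 1 := by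
  rw [lindblad_lowering]
  ext u v
  fin_cases a <;> fin_cases b <;> fin_cases u <;> fin_cases v <;> simp_all

/-- The excited state is not an eigenvector of the damping, but its traceless difference from the
ground state is. Together with the ground state and the two coherences this diagonalizes the
generator. -/
theorem lindblad_lowering_sub :
    lindblad lowering (Matrix.single 1 1 1 - Matrix.single 0 0 1)
      = (-2 : ℂ) • (Matrix.single 1 1 1 - Matrix.single 0 0 1) := by
  rw [lindblad_lowering]
  ext u v
  fin_cases u <;> fin_cases v <;> simp

/-- Amplitude damping of the excited state of register `i`. -/
theorem exp_lowering_excited (σ : Fin k → Matrix (Fin 2) (Fin 2) ℂ) (i : Fin k) (t : ℝ) :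
    NormedSpace.exp ((t : ℂ) • lindblad (onRegister i lowering))
        (insertAt σ i (Matrix.single 1 1 1))
      = insertAt σ i (Matrix.single 0 0 1)
        + Complex.exp (t * -2) • insertAt σ i (Matrix.single 1 1 1 - Matrix.single 0 0 1) := by
  have e : (Matrix.single 1 1 1 : Matrix (Fin 2) (Fin 2) ℂ)
      = Matrix.single 0 0 1 + (Matrix.single 1 1 1 - Matrix.single 0 0 1) := by abel
  conv_lhs => rw [e]
  rw [map_add, map_add, exp_lindblad_insertAt lindblad_lowering_single_zero_zero,
    exp_lindblad_insertAt lindblad_lowering_sub]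
  simp

/-- A matrix unit survives exactly when its two labels agree in every bit, that is, when it is
diagonal. -/
theorem tensorSuperop_dephase (M : Matrix (Bits k) (Bits k) ℂ) :
    tensorSuperop (fun _ => dephase) M = Matrix.diagonal fun x => M x x := by
  have h : ∀ x y : Bits k, tensorSuperop (fun _ => dephase) (Matrix.single x y 1)
      = Matrix.diagonal fun z => (Matrix.single x y (1 : ℂ)) z z := by
    intro x y
    rw [tensorSuperop_single]
    ext u v
    simp only [tensor, Matrix.of_apply, dephase, LinearMap.coe_mk, AddHom.coe_mk,
      Matrix.diagonal_apply, Matrix.single_apply]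
    rw [Finset.prod_ite_zero]
    simp [Finset.prod_ite_zero, funext_iff, forall_and]
  let D : Superop (Bits k) := LinearMap.toContinuousLinearMap
    (Matrix.diagonalLinearMap (Bits k) ℂ ℂ ∘ₗ Matrix.diagLinearMap (Bits k) ℂ ℂ)
  have : tensorSuperop (fun _ => dephase) = D := superop_ext h
  rw [this]
  rfl

theorem tensorSuperop_reset (M : Matrix (Bits k) (Bits k) ℂ) :
    tensorSuperop (fun _ => reset) M = M.trace • zeroState k := by
  have h : ∀ x y : Bits k, tensorSuperop (fun _ => reset) (Matrix.single x y 1)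
      = (Matrix.single x y (1 : ℂ)).trace • zeroState k := by
    intro x y
    rw [tensorSuperop_single]
    rw [zeroState_eq_tensor]
    rcases eq_or_ne x y with rfl | hxy
    · simp [reset_single]
    -- Distinct strings differ in some register, and there the reset annihilates the factor because
    -- its trace is zero.
    · obtain ⟨j, hj⟩ := Function.ne_iff.1 hxy
      rw [Matrix.trace_single_eq_of_ne _ _ _ hxy, zero_smul]
      ext u v
      exact Finset.prod_eq_zero (Finset.mem_univ j) (by simp [reset_single, hj])
  let D : Superop (Bits k) := LinearMap.toContinuousLinearMap
    ((Matrix.traceLinearMap (Bits k) ℂ ℂ).smulRight (zeroState k))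
  have : tensorSuperop (fun _ => reset) = D := superop_ext h
  rw [this]
  rfl

/-- There is a unitary whose conjugation gives `|0⋯0⟩` a prescribed distribution on the
computational basis. -/
theorem exists_unitary_conj_single_diag {n : Type*} [Fintype n] [DecidableEq n] (z : n) (p : n → ℝ)
    (hp : ∀ x, 0 ≤ p x) (hsum : ∑ x, p x = 1) :
    ∃ U ∈ Matrix.unitaryGroup n ℂ, ∀ x, conj U (Matrix.single z z 1) x x = p x := by
  -- A unit vector because `p` sums to one. Completed to an orthonormal basis with `ψ` at index `z`,
  -- it becomes column `z` of the unitary.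
  let ψ : EuclideanSpace ℂ n := WithLp.toLp 2 fun x => (Real.sqrt (p x) : ℂ)
  have hψ : ‖ψ‖ = 1 := by
    rw [EuclideanSpace.norm_eq]
    simp [ψ, Real.sq_sqrt (hp _), hsum]
  obtain ⟨b, hb⟩ := Orthonormal.exists_orthonormalBasis_extension_of_card_eq (𝕜 := ℂ)
    (E := EuclideanSpace ℂ n) (ι := n) finrank_euclideanSpace (v := fun _ => ψ) (s := {z}) (by
      constructor
      · intro i; simpa using hψ
      · intro i j hij; exact absurd (Subsingleton.elim i j) hij)
  refine ⟨(EuclideanSpace.basisFun n ℂ).toBasis.toMatrix b.toBasis,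
    (EuclideanSpace.basisFun n ℂ).toMatrix_orthonormalBasis_mem_unitary b, fun x => ?_⟩
  have hbz := hb z rfl
  rw [conj_apply]
  have h : ∀ y, (EuclideanSpace.basisFun n ℂ).toBasis.toMatrix b.toBasis x y = b y x := by
    intro y; simp [Module.Basis.toMatrix_apply]
  simp only [Matrix.mul_apply, Matrix.conjTranspose_apply, h, Matrix.single_apply]
  simp [ite_and, hbz, ψ, Finset.sum_ite_eq, ← Complex.ofReal_mul, Real.mul_self_sqrt (hp x)]

theorem exists_diagonalization {n : Type*} [Fintype n] [DecidableEq n] {ρ : Matrix n n ℂ}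
    (hρ : ρ ∈ densities n) : ∃ U ∈ Matrix.unitaryGroup n ℂ, ∃ p : n → ℝ, (∀ x, 0 ≤ p x) ∧
      ∑ x, p x = 1 ∧ ρ = conj U (Matrix.diagonal fun x => (p x : ℂ)) := by
  have hH := hρ.1.isHermitian
  refine ⟨hH.eigenvectorUnitary, hH.eigenvectorUnitary.2, hH.eigenvalues,
    hρ.1.eigenvalues_nonneg, ?_, ?_⟩
  · have := hH.trace_eq_sum_eigenvalues
    rw [hρ.2] at this
    apply Complex.ofReal_injective
    simpa using this.symm
  · conv_lhs => rw [hH.spectral_theorem, Unitary.conjStarAlgAut_apply]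
    rfl

end Tensor

/-! ### Preparing states and spreading dissipation over the registers. -/

section Control

theorem apply_mem_reach {n : Type*} [Fintype n] [DecidableEq n] {S : Set (Matrix n n ℂ)}
    {ρ σ : Matrix n n ℂ} (hσ : σ ∈ reach S ρ) {Φ : Superop n} (hΦ : Φ ∈ closedChan S) :
    Φ σ ∈ reach S ρ := by
  obtain ⟨Ψ, hΨ, rfl⟩ := hσ
  exact ⟨Φ * Ψ, mul_mem_closedChan hΦ hΨ, rfl⟩

theorem tendsto_cexp_mul_neg {c : ℂ} (hc : c.re < 0) :
    Tendsto (fun t : ℝ => Complex.exp (t * c)) atTop (𝓝 0) := by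
  rw [Complex.tendsto_exp_nhds_zero_iff]
  simpa using tendsto_id.atTop_mul_const_of_neg hc

variable {k : ℕ} {S : Set (Matrix (Bits k) (Bits k) ℂ)} {i : Fin k}

theorem swap_mem_closedChan (hS : GeneratesHormander S) (i j : Fin k) :
    conj (swapGate i j) ∈ closedChan S :=
  conj_mem_closedChan hS (swapGate_mem_unitaryGroup i j)

/-- Damping an excited qubit for a suitable time, and rotating it, prepares any density. -/
theorem insertAt_mem_reach (hS : GeneratesHormander S) (hl : onRegister i lowering ∈ S)
    {ω : Matrix (Bits k) (Bits k) ℂ} {σ : Fin k → Matrix (Fin 2) (Fin 2) ℂ}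
    (h : insertAt σ i (Matrix.single 0 0 1) ∈ reach S ω) {ρ : Matrix (Fin 2) (Fin 2) ℂ}
    (hρ : ρ ∈ densities (Fin 2)) : insertAt σ i ρ ∈ reach S ω := by
  obtain ⟨U, hU, p, hp, hsum, rfl⟩ := exists_diagonalization hρ
  have hloc : ∀ {V X : Matrix (Fin 2) (Fin 2) ℂ}, V ∈ Matrix.unitaryGroup (Fin 2) ℂ →
      insertAt σ i X ∈ reach S ω → insertAt σ i (conj V X) ∈ reach S ω := by
    intro V X hV hX
    have := apply_mem_reach hX (conj_mem_closedChan hS (onRegister_mem_unitaryGroup i hV))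
    rwa [conj_onRegister_insertAt] at this
  refine hloc hU ?_
  rw [Fin.sum_univ_two] at hsum
  -- Written in eigenvectors of the damping, so that `p 1` plays the role of the decay factor.
  have hd : (Matrix.diagonal fun x => (p x : ℂ)) = Matrix.single 0 0 1
      + (p 1 : ℂ) • (Matrix.single 1 1 1 - Matrix.single 0 0 1) := by
    have : (p 0 : ℂ) = 1 - p 1 := by rw [← Complex.ofReal_one, ← hsum]; push_cast; ring
    ext u v
    fin_cases u <;> fin_cases v <;> simp [this, sub_eq_add_neg]
  rw [hd]
  -- Decay to `p 1 = 0` would take infinite time, but the target is then the ground state itself.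
  -- Otherwise flip the qubit and let it decay.
  rcases (hp 1).eq_or_lt with h0 | h0
  · simpa [← h0] using h
  · let X : Matrix (Fin 2) (Fin 2) ℂ := (Equiv.swap (0 : Fin 2) 1).permMatrix ℂ
    have hX : X ∈ Matrix.unitaryGroup (Fin 2) ℂ := by
      rw [Matrix.mem_unitaryGroup_iff, Matrix.star_eq_conjTranspose,
        Matrix.conjTranspose_permMatrix, ← Matrix.permMatrix_mul, inv_mul_cancel,
        Matrix.permMatrix_one]
    have hX1 : conj X (Matrix.single 0 0 1) = Matrix.single 1 1 1 := by
      rw [conj_apply, Matrix.conjTranspose_permMatrix, PEquiv.toMatrix_toPEquiv_mul,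
        PEquiv.mul_toMatrix_toPEquiv]
      ext u v
      fin_cases u <;> fin_cases v <;> simp
    have h1 := hloc hX h
    rw [hX1] at h1
    -- The solution of `e^{-2t} = p 1`, nonnegative because `p 1 ≤ 1`.
    have ht : 0 ≤ -Real.log (p 1) / 2 := by
      have := Real.log_nonpos (hp 1) (by linarith [hp 0])
      linarith
    have h2 := apply_mem_reach h1 (jump_mem_closedChan hl ht)
    have he : Complex.exp ((-Real.log (p 1) / 2 : ℝ) * -2) = p 1 := by
      rw [show ((-Real.log (p 1) / 2 : ℝ) : ℂ) * -2 = (Real.log (p 1) : ℝ) by push_cast; ring,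
        ← Complex.ofReal_exp, Real.exp_log h0]
    rw [exp_lowering_excited, he] at h2
    rwa [map_add, map_smul]

/-- Swap register `j` into register `i`, prepare it there, and swap back. -/
theorem tensor_update_mem_reach (hS : GeneratesHormander S) (hl : onRegister i lowering ∈ S)
    {ω : Matrix (Bits k) (Bits k) ℂ} {σ : Fin k → Matrix (Fin 2) (Fin 2) ℂ}
    (h : tensor σ ∈ reach S ω) (j : Fin k) (hj : σ j = Matrix.single 0 0 1)
    {ρ : Matrix (Fin 2) (Fin 2) ℂ} (hρ : ρ ∈ densities (Fin 2)) :
    tensor (Function.update σ j ρ) ∈ reach S ω := by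
  have h1 := apply_mem_reach h (swap_mem_closedChan hS i j)
  rw [conj_swapGate_tensor, ← insertAt_self _ i, Function.comp_apply, Equiv.swap_apply_left, hj]
    at h1
  have h2 := apply_mem_reach (insertAt_mem_reach hS hl h1 hρ) (swap_mem_closedChan hS i j)
  rw [insertAt_apply, conj_swapGate_tensor, Function.update_comp_equiv] at h2
  convert! h2 using 2
  ext1 l
  rcases eq_or_ne l j with rfl | hlj
  · simp
  · simp [Function.update_of_ne, hlj]

/-- All product densities can be prepared from `|0⋯0⟩` with the help of amplitude damping. -/
theorem tensor_mem_reach_zeroState (hS : GeneratesHormander S) (hl : onRegister i lowering ∈ S)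
    {ρ : Fin k → Matrix (Fin 2) (Fin 2) ℂ} (hρ : ∀ j, ρ j ∈ densities (Fin 2)) :
    tensor ρ ∈ reach S (zeroState k) := by
  -- Induction on the set of prepared registers; the others remain in the ground state from which
  -- preparation starts.
  have key : ∀ s : Finset (Fin k),
      tensor (fun j => if j ∈ s then ρ j else Matrix.single 0 0 1) ∈ reach S (zeroState k) := by
    intro s
    induction s using Finset.induction_on with
    | empty =>
      refine ⟨1, one_mem_closedChan, ?_⟩
      simp [zeroState_eq_tensor]
    | insert a s ha ih =>
      have := tensor_update_mem_reach hS hl ih a (by simp [ha]) (hρ a)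
      convert! this using 2
      ext1 j
      rcases eq_or_ne j a with rfl | hj
      · simp
      · simp [hj]
  simpa using key Finset.univ

theorem tensorSuperop_update_id_tensor (i : Fin k)
    (Θ : Matrix (Fin 2) (Fin 2) ℂ →ₗ[ℂ] Matrix (Fin 2) (Fin 2) ℂ)
    (σ : Fin k → Matrix (Fin 2) (Fin 2) ℂ) :
    tensorSuperop (Function.update (fun _ => LinearMap.id) i Θ) (tensor σ)
      = insertAt σ i (Θ (σ i)) := by
  rw [tensorSuperop_tensor, insertAt_apply]
  congr 1
  ext1 j
  rcases eq_or_ne j i with rfl | h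
  · simp
  · simp [Function.update_of_ne h]

/-- The long-time limit of the dephasing semigroup of one register. -/
theorem dephase_register_mem_closedChan (hz : onRegister i pauliZ ∈ S) :
    tensorSuperop (Function.update (fun _ => LinearMap.id) i dephase) ∈ closedChan S := by
  refine isClosed_closedChan.mem_of_tendsto (tendsto_superop fun x y => ?_)
    ((eventually_ge_atTop (0 : ℝ)).mono fun t ht => jump_mem_closedChan hz ht)
  rw [← tensor_single, tensorSuperop_update_id_tensor, dephase_single, ← insertAt_self _ i]
  simp only [exp_lindblad_insertAt (lindblad_pauliZ_single _ _)]
  split_ifs with h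
  · simp
  · have := (tendsto_cexp_mul_neg (c := -4) (by norm_num)).smul_const
      (insertAt (fun j => Matrix.single (x j) (y j) (1 : ℂ)) i (Matrix.single (x i) (y i) 1))
    simpa using this

/-- The long-time limit of the amplitude damping of one register. -/
theorem reset_register_mem_closedChan (hl : onRegister i lowering ∈ S) :
    tensorSuperop (Function.update (fun _ => LinearMap.id) i reset) ∈ closedChan S := by
  refine isClosed_closedChan.mem_of_tendsto (tendsto_superop fun x y => ?_)
    ((eventually_ge_atTop (0 : ℝ)).mono fun t ht => jump_mem_closedChan hl ht)
  rw [← tensor_single, tensorSuperop_update_id_tensor, reset_single, ← insertAt_self _ i]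
  generalize (fun j => Matrix.single (x j) (y j) (1 : ℂ)) = σ
  generalize x i = a
  generalize y i = b
  split_ifs with h
  · subst h
    fin_cases a
    · simp [exp_lindblad_insertAt lindblad_lowering_single_zero_zero]
    -- The excited population is not an eigenvector: it tends to the ground state plus a term
    -- decaying like `e^{-2t}`.
    · simp only [Fin.mk_one, exp_lowering_excited]
      have := (tendsto_cexp_mul_neg (c := -2) (by norm_num)).smul_const
        (insertAt σ i (Matrix.single 1 1 1 - Matrix.single 0 0 1))
      simpa using this.const_add (insertAt σ i (Matrix.single 0 0 1))
  · simp only [exp_lindblad_insertAt (lindblad_lowering_single_of_ne h)]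
    have := (tendsto_cexp_mul_neg (c := -1) (by norm_num)).smul_const
      (insertAt σ i (Matrix.single a b 1))
    simpa using this

/-- A one-qubit operation available in one register can be applied in all of them. -/
theorem tensorSuperop_mem_closedChan_of_register (hS : GeneratesHormander S)
    {Θ : Matrix (Fin 2) (Fin 2) ℂ →ₗ[ℂ] Matrix (Fin 2) (Fin 2) ℂ}
    (h : tensorSuperop (Function.update (fun _ => LinearMap.id) i Θ) ∈ closedChan S) :
    tensorSuperop (fun _ : Fin k => Θ) ∈ closedChan S := by
  have hj : ∀ j, tensorSuperop (Function.update (fun _ => LinearMap.id) j Θ) ∈ closedChan S := by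
    intro j
    have := mul_mem_closedChan (mul_mem_closedChan (swap_mem_closedChan hS i j) h)
      (swap_mem_closedChan hS i j)
    rw [conj_swapGate_tensorSuperop, Function.update_comp_equiv] at this
    simpa [Function.comp_def] using this
  have key : ∀ s : Finset (Fin k),
      tensorSuperop (fun j => if j ∈ s then Θ else LinearMap.id) ∈ closedChan S := by
    intro s
    induction s using Finset.induction_on with
    | empty => simpa [tensorSuperop_id] using one_mem_closedChan
    | insert a s ha ih =>
      have := mul_mem_closedChan (hj a) ih
      rw [tensorSuperop_mul] at this
      convert! this using 2
      ext1 j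
      rcases eq_or_ne j a with rfl | h'
      · simp [ha]
      · simp [h']
  simpa using key Finset.univ

theorem zeroState_mem_densities : zeroState k ∈ densities (Bits k) := by
  constructor
  · rw [zeroState, ← Matrix.diagonal_single]
    exact Matrix.PosSemidef.diagonal (Pi.single_nonneg.2 zero_le_one)
  · simp [zeroState]

/-- Dephasing all registers turns suitable pure states into arbitrary diagonal densities. -/
theorem reach_zeroState_eq_densities (hS : GeneratesHormander S) (hz : onRegister i pauliZ ∈ S) :
    reach S (zeroState k) = densities (Bits k) := by
  refine Set.Subset.antisymm ?_ fun ρ hρ => ?_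
  · rintro _ ⟨Φ, hΦ, rfl⟩
    exact closedChan_mapsTo_densities hΦ zeroState_mem_densities
  · obtain ⟨U, hU, p, hp, hsum, rfl⟩ := exists_diagonalization hρ
    -- `V` produces a pure state whose diagonal is the spectrum `p`; dephasing removes its
    -- coherences, and `U` rotates the result to the eigenbasis of the target.
    obtain ⟨V, hV, hVp⟩ := exists_unitary_conj_single_diag (fun _ => 0 : Bits k) p hp hsum
    refine apply_mem_reach ?_ (conj_mem_closedChan hS hU)
    refine ⟨tensorSuperop (fun _ => dephase) * conj V, mul_mem_closedChan
      (tensorSuperop_mem_closedChan_of_register hS (dephase_register_mem_closedChan hz))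
      (conj_mem_closedChan hS hV), ?_⟩
    rw [mul_apply_eq_comp, tensorSuperop_dephase]
    exact congrArg _ (funext hVp)

/-- Resetting every register sends each density to the zero state, so it suffices that this state
reaches everything. -/
theorem isTransitive_closedChan (hS : GeneratesHormander S) (hl : onRegister i lowering ∈ S)
    (hz : onRegister i pauliZ ∈ S) : IsTransitive (closedChan S) := by
  intro ρ hρ σ hσ
  rw [← reach_zeroState_eq_densities hS hz] at hσ
  obtain ⟨Φ, hΦ, rfl⟩ := hσ
  refine ⟨Φ * tensorSuperop (fun _ => reset), mul_mem_closedChan hΦ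
    (tensorSuperop_mem_closedChan_of_register hS (reset_register_mem_closedChan hl)), ?_⟩
  rw [mul_apply_eq_comp, tensorSuperop_reset, hρ.2, one_smul]

end Control

end QubitControl

theorem theorem2p10 (k : ℕ) (hk : 1 ≤ k) (S : Set (Matrix (Bits k) (Bits k) ℂ))
    (hstar : ∀ a ∈ S, aᴴ ∈ S) (hS : GeneratesHormander S) :
    (onRegister ⟨0, hk⟩ lowering ∈ S →
      ∀ ρ : Fin k → Matrix (Fin 2) (Fin 2) ℂ, (∀ j, ρ j ∈ densities (Fin 2)) →
        tensor ρ ∈ reach S (zeroState k)) ∧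
    (onRegister ⟨0, hk⟩ pauliZ ∈ S →
      tensorSuperop (Function.update (fun _ => LinearMap.id) ⟨0, hk⟩ dephase) ∈ closedChan S ∧
      tensorSuperop (fun _ : Fin k => dephase) ∈ closedChan S) ∧
    (onRegister ⟨0, hk⟩ lowering ∈ S → onRegister ⟨0, hk⟩ pauliZ ∈ S →
      reach S (zeroState k) = densities (Bits k) ∧ IsTransitive (closedChan S)) :=
  ⟨fun hl _ hρ => tensor_mem_reach_zeroState hS hl hρ,
    fun hz => ⟨dephase_register_mem_closedChan hz,
      tensorSuperop_mem_closedChan_of_register hS (dephase_register_mem_closedChan hz)⟩,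
    fun hl hz => ⟨reach_zeroState_eq_densities hS hz, isTransitive_closedChan hS hl hz⟩⟩
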